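/- For integers $n\ge 1$ and $k$ let $T_n(k)=\sum_{i\text{ odd}}\binom ni i^k$ (a positive rational number with odd denominator), and let $\nu$ denote the exponent of $2$, extended to the field of 2-adic numbers, with $\nu(0)=\infty$. **Theorem 1.2.** For each $1\le n\le 36$ the congruence classes listed for $n$ below form a partition of $\mathbb Z$ into finitely many congruence classes $C=[i \bmod 2^m]$, and for each listed class one of the following holds. (a) If a value $c_0$ is listed for $C=[i\bmod 2^m]$, then $c_0$ is positive and there is a 2-adic integer $x_0$ such that $$\nu(T_n(2^mx+i))=\nu(x-x_0)+c_0\quad\text{for all integers }x ,$$ where both sides are finite. Moreover, if $g(x)=\nu(T_n(2^mx+i))-c_0$, then $x_0=2^{t_0}+2^{t_1}+\cdots$ (convergent in the 2-adic integers), where the nonnegative integers $t_j$ are given by $t_0=g(0)$ and $t_{j+1}=g(2^{t_0}+\cdots+2^{t_j})$ for $j\ge0$. (b) If a value $y_0$ is listed for $C$, then $\nu(T_n(k))=y_0$ for all $k\in C$, and $y_0$ is positive if $n\ge2$. In the list, "$i_1,i_2,\ldots\ (M)$: $c_0=c$" (or "$y_0=y$") means that each of the classes $[i_1 \bmod M],[i_2\bmod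 M],\ldots$, with $M=2^m$, is listed with that value, and that in (a) the integer $i$ is the displayed representative. - $n=1$: $0\ (1)$: $y_0=0$. - $n=2$: $0\ (1)$: $y_0=1$. - $n=3$: $0\ (2)$: $y_0=2$; $1\ (2)$: $y_0=1$. - $n=4$: $0\ (2)$: $y_0=3$; $1\ (2)$: $y_0=4$. - $n=5$: $0,1\ (2)$: $c_0=3$. - $n=6$: $0,1\ (2)$: $c_0=4$. - $n=7$: $0\ (2)$: $c_0=6$; $1\ (2)$: $c_0=4$. - $n=8$: $0\ (2)$: $c_0=7$; $1\ (2)$: $c_0=9$. - $n=9$: $0,1,2,3\ (4)$: $c_0=7$. - $n=10$: $0,1,2,3\ (4)$: $c_0=8$. - $n=11$: $0,2\ (4)$: $c_0=9$; $1,3\ (4)$: $c_0=8$. - $n=12$: $0,2\ (4)$: $c_0=10$; $1,3\ (4)$: $c_0=11$. - $n=13$: $1,2\ (4)$: $c_0=10$; $0,4\ (8)$: $c_0=12$; $7\ (8)$: $y_0=11$; $3\ (16)$: $y_0=13$; $11\ (16)$: $y_0=15$. - $n=14$: $2,3\ (4)$: $c_0=11$; $0,1\ (8)$: $c_0=13$;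 $4,5\ (8)$: $c_0=13$. - $n=15$: $3\ (4)$: $c_0=11$; $0\ (4)$: $c_0=14$; $1,5\ (8)$: $c_0=13$; $2,6\ (8)$: $c_0=16$. - $n=16$: $0\ (4)$: $c_0=15$; $1\ (4)$: $c_0=18$; $2,6\ (8)$: $c_0=17$; $3,7\ (8)$: $c_0=20$. - $n=17$: $0,1,2,3,4,5,6,7\ (8)$: $c_0=15$. - $n=18$: $0,1,2,3,4,5,6,7\ (8)$: $c_0=16$. - $n=19$: $0,2,4,6\ (8)$: $c_0=17$; $1,3,5,7\ (8)$: $c_0=16$. - $n=20$: $0,2,4,6\ (8)$: $c_0=18$; $1,3,5,7\ (8)$: $c_0=19$. - $n=21$: $1,2,5,6\ (8)$: $c_0=18$; $0,3\ (8)$: $c_0=19$; $7,15\ (16)$: $c_0=21$; $12\ (16)$: $y_0=20$; $4\ (32)$: $y_0=22$; $52\ (64)$: $y_0=24$; $84\ (128)$: $y_0=26$; $20\ (256)$: $y_0=28$; $148\ (256)$: $y_0=29$. - $n=22$: $0,1\ (8)$: $c_0=20$; $2,3,6,7\ (8)$: $c_0=19$; $4,12\ (16)$: $c_0=22$; $5,21\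 (32)$: $c_0=24$; $13\ (16)$: $y_0=21$. - $n=23$: $0,4\ (8)$: $c_0=21$; $3,7\ (8)$: $c_0=19$; $1\ (8)$: $c_0=20$; $2\ (8)$: $c_0=22$; $6,22\ (32)$: $c_0=26$; $5,21\ (32)$: $c_0=24$; $13\ (16)$: $y_0=21$; $14\ (16)$: $y_0=23$. - $n=24$: $0,4\ (8)$: $c_0=22$; $1,5\ (8)$: $c_0=24$; $2\ (8)$: $c_0=23$; $3\ (8)$: $c_0=25$; $6,22\ (32)$: $c_0=27$; $7,23\ (32)$: $c_0=29$; $14\ (16)$: $y_0=24$; $15\ (16)$: $y_0=26$. - $n=25$: $1,2,3,4\ (8)$: $c_0=22$; $5,6,7,8\ (16)$: $c_0=24$; $0,13,14,15\ (16)$: $c_0=24$. - $n=26$: $2,3,4,5\ (8)$: $c_0=23$; $0,1,7,8,9,15\ (16)$: $c_0=25$; $6,22\ (32)$: $c_0=27$; $14\ (16)$: $y_0=24$. - $n=27$: $3,5\ (8)$: $c_0=23$; $4,6\ (8)$: $c_0=24$; $1,7,9,15\ (16)$: $c_0=25$; $0,2,8,10\ (16)$: $c_0=26$. - $n=28$: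 $4,6\ (8)$: $c_0=25$; $5,7\ (8)$: $c_0=26$; $0,2,8,10\ (16)$: $c_0=27$; $1,3,9,11\ (16)$: $c_0=28$. - $n=29$: $5,6\ (8)$: $c_0=25$; $7\ (8)$: $c_0=26$; $1,2,9,10\ (16)$: $c_0=27$; $0,4,8,12\ (16)$: $c_0=28$; $11\ (16)$: $c_0=29$; $3\ (32)$: $y_0=30$; $19\ (32)$: $y_0=31$. - $n=30$: $6,7\ (8)$: $c_0=26$; $2,3,10,11\ (16)$: $c_0=28$; $0,1,8,9\ (16)$: $c_0=29$; $4,5,12,13\ (16)$: $c_0=29$. - $n=31$: $7\ (8)$: $c_0=26$; $0\ (8)$: $c_0=30$; $3,11\ (16)$: $c_0=28$; $1,5,9,13\ (16)$: $c_0=29$; $4,12\ (16)$: $c_0=32$; $2,6,10,14\ (16)$: $c_0=33$. - $n=32$: $0\ (8)$: $c_0=31$; $1\ (8)$: $c_0=35$; $4,12\ (16)$: $c_0=33$; $2,6,10,14\ (16)$: $c_0=34$; $5,13\ (16)$: $c_0=37$; $3,7,11,15\ (16)$: $c_0=38$. - $n=33$: $0,1,2,3,4,5,6,7,8,9,10,11,12,13,14,15\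 (16)$: $c_0=31$. - $n=34$: $0,1,2,3,4,5,6,7,8,9,10,11,12,13,14,15\ (16)$: $c_0=32$. - $n=35$: $0,2,4,6,8,10,12,14\ (16)$: $c_0=33$; $1,3,5,7,9,11,13,15\ (16)$: $c_0=32$. - $n=36$: $0,2,4,6,8,10,12,14\ (16)$: $c_0=34$; $1,3,5,7,9,11,13,15\ (16)$: $c_0=35$. -/

import Mathlib

/-- The partial Stirling number `T_n(k) = ∑_{i odd} (n choose i) i ^ k`, for every integer `k`;
it is a rational number with odd denominator when `k` is negative. -/
def partialStirling (n : ℕ) (k : ℤ) : ℚ :=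
  ∑ i ∈ (Finset.range (n + 1)).filter Odd, (n.choose i : ℚ) * (i : ℚ) ^ k

/-- `T_n(k)` is positive for `n ≥ 1`, so its exponent of `2` is always a genuine integer. -/
theorem partialStirling_pos {n : ℕ} (hn : 1 ≤ n) (k : ℤ) : 0 < partialStirling n k := by
  unfold partialStirling
  apply Finset.sum_pos
  · intro i hi
    rw [Finset.mem_filter, Finset.mem_range] at hi
    have h1 : 0 < n.choose i := Nat.choose_pos (by omega)
    have h2 : 0 < i := hi.2.pos
    positivity
  · exact ⟨1, by simp; omega⟩

/-- `ν(T_n(k))`, the exponent of `2` in `T_n(k)`. -/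
def nuT (n : ℕ) (k : ℤ) : ℤ := padicValRat 2 (partialStirling n k)

/-- The behaviour of `ν(T_n(-))` on a congruence class: `root c₀` stands for
`ν(T_n(2 ^ m * x + i)) = ν(x - x₀) + c₀` with some 2-adic integer `x₀`, and
`const y₀` for `ν(T_n(k)) = y₀` on the class. -/
inductive ClassBehaviour where
  | root (c₀ : ℕ)
  | const (y₀ : ℕ)

/-- A row of the table: the classes of the listed integers `i` modulo `2 ^ modExp`, together
with the common behaviour of `ν(T_n(-))` on these classes. -/
structure TableRow where
  residues : List ℤ
  modExp : ℕ
  behaviour : ClassBehaviour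

/-- The table of congruence classes for `1 ≤ n ≤ 36`. In `⟨[i₁, i₂, …], m, b⟩` the second entry
is the exponent `m` of the modulus `2 ^ m`. -/
def stirlingTable : ℕ → List TableRow
  | 1 => [⟨[0], 0, .const 0⟩]
  | 2 => [⟨[0], 0, .const 1⟩]
  | 3 => [⟨[0], 1, .const 2⟩, ⟨[1], 1, .const 1⟩]
  | 4 => [⟨[0], 1, .const 3⟩, ⟨[1], 1, .const 4⟩]
  | 5 => [⟨[0, 1], 1, .root 3⟩]
  | 6 => [⟨[0, 1], 1, .root 4⟩]
  | 7 => [⟨[0], 1, .root 6⟩, ⟨[1], 1, .root 4⟩]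
  | 8 => [⟨[0], 1, .root 7⟩, ⟨[1], 1, .root 9⟩]
  | 9 => [⟨[0, 1, 2, 3], 2, .root 7⟩]
  | 10 => [⟨[0, 1, 2, 3], 2, .root 8⟩]
  | 11 => [⟨[0, 2], 2, .root 9⟩, ⟨[1, 3], 2, .root 8⟩]
  | 12 => [⟨[0, 2], 2, .root 10⟩, ⟨[1, 3], 2, .root 11⟩]
  | 13 => [⟨[1, 2], 2, .root 10⟩, ⟨[0, 4], 3, .root 12⟩, ⟨[7], 3, .const 11⟩,
      ⟨[3], 4, .const 13⟩, ⟨[11], 4, .const 15⟩]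
  | 14 => [⟨[2, 3], 2, .root 11⟩, ⟨[0, 1], 3, .root 13⟩, ⟨[4, 5], 3, .root 13⟩]
  | 15 => [⟨[3], 2, .root 11⟩, ⟨[0], 2, .root 14⟩, ⟨[1, 5], 3, .root 13⟩, ⟨[2, 6], 3, .root 16⟩]
  | 16 => [⟨[0], 2, .root 15⟩, ⟨[1], 2, .root 18⟩, ⟨[2, 6], 3, .root 17⟩, ⟨[3, 7], 3, .root 20⟩]
  | 17 => [⟨[0, 1, 2, 3, 4, 5, 6, 7], 3, .root 15⟩]
  | 18 => [⟨[0, 1, 2, 3, 4, 5, 6, 7], 3, .root 16⟩]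
  | 19 => [⟨[0, 2, 4, 6], 3, .root 17⟩, ⟨[1, 3, 5, 7], 3, .root 16⟩]
  | 20 => [⟨[0, 2, 4, 6], 3, .root 18⟩, ⟨[1, 3, 5, 7], 3, .root 19⟩]
  | 21 => [⟨[1, 2, 5, 6], 3, .root 18⟩, ⟨[0, 3], 3, .root 19⟩, ⟨[7, 15], 4, .root 21⟩,
      ⟨[12], 4, .const 20⟩, ⟨[4], 5, .const 22⟩, ⟨[52], 6, .const 24⟩,
      ⟨[84], 7, .const 26⟩, ⟨[20], 8, .const 28⟩, ⟨[148], 8, .const 29⟩]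
  | 22 => [⟨[0, 1], 3, .root 20⟩, ⟨[2, 3, 6, 7], 3, .root 19⟩, ⟨[4, 12], 4, .root 22⟩,
      ⟨[5, 21], 5, .root 24⟩, ⟨[13], 4, .const 21⟩]
  | 23 => [⟨[0, 4], 3, .root 21⟩, ⟨[3, 7], 3, .root 19⟩, ⟨[1], 3, .root 20⟩,
      ⟨[2], 3, .root 22⟩, ⟨[6, 22], 5, .root 26⟩, ⟨[5, 21], 5, .root 24⟩,
      ⟨[13], 4, .const 21⟩, ⟨[14], 4, .const 23⟩]
  | 24 => [⟨[0, 4], 3, .root 22⟩, ⟨[1, 5], 3, .root 24⟩, ⟨[2], 3, .root 23⟩,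
      ⟨[3], 3, .root 25⟩, ⟨[6, 22], 5, .root 27⟩, ⟨[7, 23], 5, .root 29⟩,
      ⟨[14], 4, .const 24⟩, ⟨[15], 4, .const 26⟩]
  | 25 => [⟨[1, 2, 3, 4], 3, .root 22⟩, ⟨[5, 6, 7, 8], 4, .root 24⟩,
      ⟨[0, 13, 14, 15], 4, .root 24⟩]
  | 26 => [⟨[2, 3, 4, 5], 3, .root 23⟩, ⟨[0, 1, 7, 8, 9, 15], 4, .root 25⟩,
      ⟨[6, 22], 5, .root 27⟩, ⟨[14], 4, .const 24⟩]
  | 27 => [⟨[3, 5], 3, .root 23⟩, ⟨[4, 6], 3, .root 24⟩, ⟨[1, 7, 9, 15], 4, .root 25⟩,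
      ⟨[0, 2, 8, 10], 4, .root 26⟩]
  | 28 => [⟨[4, 6], 3, .root 25⟩, ⟨[5, 7], 3, .root 26⟩, ⟨[0, 2, 8, 10], 4, .root 27⟩,
      ⟨[1, 3, 9, 11], 4, .root 28⟩]
  | 29 => [⟨[5, 6], 3, .root 25⟩, ⟨[7], 3, .root 26⟩, ⟨[1, 2, 9, 10], 4, .root 27⟩,
      ⟨[0, 4, 8, 12], 4, .root 28⟩, ⟨[11], 4, .root 29⟩, ⟨[3], 5, .const 30⟩,
      ⟨[19], 5, .const 31⟩]
  | 30 => [⟨[6, 7], 3, .root 26⟩, ⟨[2, 3, 10, 11], 4, .root 28⟩, ⟨[0, 1, 8, 9], 4, .root 29⟩,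
      ⟨[4, 5, 12, 13], 4, .root 29⟩]
  | 31 => [⟨[7], 3, .root 26⟩, ⟨[0], 3, .root 30⟩, ⟨[3, 11], 4, .root 28⟩,
      ⟨[1, 5, 9, 13], 4, .root 29⟩, ⟨[4, 12], 4, .root 32⟩, ⟨[2, 6, 10, 14], 4, .root 33⟩]
  | 32 => [⟨[0], 3, .root 31⟩, ⟨[1], 3, .root 35⟩, ⟨[4, 12], 4, .root 33⟩,
      ⟨[2, 6, 10, 14], 4, .root 34⟩, ⟨[5, 13], 4, .root 37⟩, ⟨[3, 7, 11, 15], 4, .root 38⟩]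
  | 33 => [⟨[0, 1, 2, 3, 4, 5, 6, 7, 8, 9, 10, 11, 12, 13, 14, 15], 4, .root 31⟩]
  | 34 => [⟨[0, 1, 2, 3, 4, 5, 6, 7, 8, 9, 10, 11, 12, 13, 14, 15], 4, .root 32⟩]
  | 35 => [⟨[0, 2, 4, 6, 8, 10, 12, 14], 4, .root 33⟩,
      ⟨[1, 3, 5, 7, 9, 11, 13, 15], 4, .root 32⟩]
  | 36 => [⟨[0, 2, 4, 6, 8, 10, 12, 14], 4, .root 34⟩,
      ⟨[1, 3, 5, 7, 9, 11, 13, 15], 4, .root 35⟩]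
  | _ => []

/-- The class `[i mod 2 ^ m]` is listed in the table for `n`, with behaviour `b`. -/
def IsTableEntry (n : ℕ) (i : ℤ) (m : ℕ) (b : ClassBehaviour) : Prop :=
  ∃ r ∈ stirlingTable n, i ∈ r.residues ∧ r.modExp = m ∧ r.behaviour = b

/-- The congruence class `[i mod 2 ^ m]` in `ℤ`. -/
def congClass (i : ℤ) (m : ℕ) : Set ℤ := {k | k ≡ i [ZMOD 2 ^ m]}

/-! On a class put `w_j = j ^ 2 ^ m - 1` and `a_j = (n choose j) j ^ i` for odd `j`. Then `f(x) =
T_n(2 ^ m x + i)` equals `∑ a_j (1 + w_j) ^ x`, with Mahler coefficients `M_r = ∑ a_j w_j ^ r`.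

If `ν(M_1) = c` and `ν(M_r) ≥ c + r` for `r ≥ 2`, the linear term dominates every difference, so
`ν(f(x) - f(y)) = ν(x - y) + c` (`norm_sum_one_add_pow_sub`). If also `ν(f(0)) ≥ c`, adding `2 ^
(ν(f(x)) - c)` to `x` strictly increases `ν(f(x))`. Iteration from 0 converges to the zero `x₀`, and
the distance formula passes to the limit (`exists_padic_root`). If instead `ν(M_0) = c < ν(M_r)` for
all `r ≥ 1`, then `ν(f)` is constantly `c` (`norm_sum_one_add_pow`).

Since `2 ^ (m + 1)` divides each `w_j`, only finitely many `r` need computation. Negative exponents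
reduce to natural ones by 2-adic continuity, and the partition is checked modulo the largest
modulus. -/

/-! ### Zeros of maps that scale 2-adic distances -/

/-- The residue field has two elements, so the unit `a / b` reduces to 1 and `a / b + 1` reduces to
0. This is special to the prime 2. -/
theorem padic_two_norm_add_lt {a b : ℚ_[2]} (hab : ‖a‖ = ‖b‖) (hb : b ≠ 0) : ‖a + b‖ < ‖b‖ := by
  have hb' : 0 < ‖b‖ := norm_pos_iff.2 hb
  have hu : ‖a / b‖ = 1 := by rw [norm_div, hab, div_self hb'.ne']
  let u : ℤ_[2] := ⟨a / b, hu.le⟩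
  have h2 : ‖u + 1‖ < 1 := by
    rw [← PadicInt.mem_nonunits, ← IsLocalRing.mem_maximalIdeal, ← PadicInt.ker_toZMod,
      RingHom.mem_ker, map_add, map_one]
    have hz : PadicInt.toZMod u ≠ 0 := by
      intro h
      rw [← RingHom.mem_ker, PadicInt.ker_toZMod, IsLocalRing.mem_maximalIdeal,
        PadicInt.mem_nonunits] at h
      exact absurd hu h.ne
    generalize PadicInt.toZMod u = z at hz
    revert hz; revert z; decide
  have h3 : a + b = (a / b + 1) * b := by field_simp
  have h4 : ‖a / b + 1‖ < 1 := h2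
  rw [h3, norm_mul]
  nlinarith

theorem norm_eq_two_zpow_neg_valuation {a : ℚ_[2]} (ha : a ≠ 0) :
    ‖a‖ = (2 : ℝ) ^ (-a.valuation) := by
  simpa using Padic.norm_eq_zpow_neg_valuation ha

/-- A nonvanishing function on `ℤ` that scales 2-adic distances by `2 ^ (-c)` is, up to a unit,
`2 ^ c` times the distance to a 2-adic integer, which the greedy iteration computes. -/
theorem exists_padic_root (f : ℤ → ℚ_[2]) (c : ℕ) (hne : ∀ x, f x ≠ 0)
    (h0 : ‖f 0‖ ≤ (2 : ℝ) ^ (-(c : ℤ)))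
    (hf : ∀ x y, ‖f x - f y‖ = (2 : ℝ) ^ (-(c : ℤ)) * ‖((x - y : ℤ) : ℚ_[2])‖) :
    ∃ x₀ : ℤ_[2],
      (∀ x : ℤ, (x : ℤ_[2]) - x₀ ≠ 0 ∧
        (f x).valuation = (((x : ℤ_[2]) - x₀).valuation : ℤ) + (c : ℤ)) ∧
      ∃ t : ℕ → ℕ,
        (t 0 : ℤ) = (f 0).valuation - (c : ℤ) ∧
        (∀ j : ℕ, (t (j + 1) : ℤ) =
          (f (∑ l ∈ Finset.range (j + 1), (2 : ℤ) ^ t l)).valuation - (c : ℤ)) ∧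
        HasSum (fun j : ℕ => (2 : ℤ_[2]) ^ t j) x₀ := by
  have hc : (0 : ℝ) < 2 ^ (-(c : ℤ)) := by positivity
  have hle : ∀ x, ‖f x‖ ≤ (2 : ℝ) ^ (-(c : ℤ)) := by
    intro x
    have h1 : ‖f x - f 0‖ ≤ (2 : ℝ) ^ (-(c : ℤ)) := by
      rw [hf]
      exact mul_le_of_le_one_right hc.le (Padic.norm_int_le_one _)
    have h2 := Padic.nonarchimedean (f x - f 0) (f 0)
    rw [sub_add_cancel] at h2
    exact h2.trans (max_le h1 h0)
  have hval : ∀ x, (c : ℤ) ≤ (f x).valuation := by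
    intro x
    have h := hle x
    rw [norm_eq_two_zpow_neg_valuation (hne x)] at h
    have := (zpow_le_zpow_iff_right₀ (by norm_num : (1 : ℝ) < 2)).1 h
    omega
  let e : ℤ → ℕ := fun x => ((f x).valuation - c).toNat
  have he : ∀ x, (e x : ℤ) = (f x).valuation - c := fun x =>
    Int.toNat_of_nonneg (by have := hval x; omega)
  have hnorm : ∀ x, ‖f x‖ = (2 : ℝ) ^ (-(c : ℤ)) * 2 ^ (-(e x : ℤ)) := by
    intro x
    rw [norm_eq_two_zpow_neg_valuation (hne x), he, ← zpow_add₀ (by norm_num)]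
    congr 1; ring
  -- The greedy partial sums, starting from the empty sum 0.
  let s : ℕ → ℤ := fun j => Nat.rec 0 (fun _ a => a + 2 ^ e a) j
  have hs : ∀ j, s (j + 1) = s j + 2 ^ e (s j) := fun j => rfl
  have hsum : ∀ j, s j = ∑ l ∈ Finset.range j, (2 : ℤ) ^ e (s l) := by
    intro j
    induction j with
    | zero => rfl
    | succ j ih => rw [hs, Finset.sum_range_succ, ← ih]
  have hpow : ∀ k : ℕ, ‖(2 : ℚ_[2]) ^ k‖ = (2 : ℝ) ^ (-(k : ℤ)) := by
    intro k
    simpa using Padic.norm_p_pow (p := 2) k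
  have hlt : ∀ j, e (s j) < e (s (j + 1)) := by
    intro j
    -- The increment `2 ^ e (s j)` is chosen so that `f` changes by exactly the norm of `f (s j)`;
    -- two terms of equal norm then add up to a smaller one.
    have h1 : ‖f (s (j + 1)) - f (s j)‖ = ‖f (s j)‖ := by
      rw [hf, hnorm, hs, add_sub_cancel_left, Int.cast_pow, Int.cast_ofNat, hpow]
    have h2 := padic_two_norm_add_lt h1 (hne _)
    rw [sub_add_cancel, hnorm, hnorm, mul_lt_mul_iff_right₀ hc,
      zpow_lt_zpow_iff_right₀ (by norm_num)] at h2
    omega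
  have hmono : StrictMono fun j => e (s j) := strictMono_nat_of_lt_succ hlt
  have hpow' : ∀ k : ℕ, ‖(2 : ℤ_[2]) ^ k‖ = (1 / 2 : ℝ) ^ k := by
    intro k
    have := PadicInt.norm_p_pow (p := 2) k
    rw [zpow_neg, zpow_natCast] at this
    simpa using this
  have hsummable : Summable fun j : ℕ => (2 : ℤ_[2]) ^ e (s j) := by
    refine Summable.of_norm_bounded summable_geometric_two fun j => ?_
    rw [hpow']
    exact pow_le_pow_of_le_one (by norm_num) (by norm_num) (hmono.id_le j)
  obtain ⟨x₀, hx₀⟩ := hsummable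
  have hlim : Filter.Tendsto (fun j => (Int.cast (s j) : ℤ_[2])) Filter.atTop (nhds x₀) := by
    refine hx₀.tendsto_sum_nat.congr fun j => ?_
    rw [hsum j]; push_cast; rfl
  have hflim : Filter.Tendsto (fun j => f (s j)) Filter.atTop (nhds 0) := by
    rw [tendsto_zero_iff_norm_tendsto_zero]
    refine squeeze_zero (fun _ => norm_nonneg _) (g := fun j : ℕ => (1 / 2 : ℝ) ^ j)
      (fun j => ?_) (tendsto_pow_atTop_nhds_zero_of_lt_one (by norm_num) (by norm_num))
    rw [hnorm, zpow_neg, zpow_neg, zpow_natCast, zpow_natCast, one_div, inv_pow]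
    have h1 : ((2 : ℝ) ^ c)⁻¹ ≤ 1 := inv_le_one_of_one_le₀ (one_le_pow₀ (by norm_num))
    have h2 : ((2 : ℝ) ^ e (s j))⁻¹ ≤ (2 ^ j)⁻¹ :=
      inv_anti₀ (by positivity) (pow_le_pow_right₀ (by norm_num) (hmono.id_le j))
    calc _ ≤ 1 * ((2 : ℝ) ^ e (s j))⁻¹ := by gcongr
      _ ≤ _ := by rwa [one_mul]
  -- Let `j → ∞` in `hf x (s j)`; `f` need not be extended to the 2-adic integers.
  have hroot : ∀ x : ℤ, ‖f x‖ = (2 : ℝ) ^ (-(c : ℤ)) * ‖(x : ℤ_[2]) - x₀‖ := by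
    intro x
    have hl : Filter.Tendsto (fun j => ‖f x - f (s j)‖) Filter.atTop (nhds ‖f x - 0‖) :=
      (tendsto_const_nhds.sub hflim).norm
    have hr : Filter.Tendsto (fun j => (2 : ℝ) ^ (-(c : ℤ)) * ‖(x : ℤ_[2]) - Int.cast (s j)‖)
        Filter.atTop (nhds ((2 : ℝ) ^ (-(c : ℤ)) * ‖(x : ℤ_[2]) - x₀‖)) :=
      (tendsto_const_nhds.sub hlim).norm.const_mul _
    rw [sub_zero] at hl
    refine tendsto_nhds_unique hl (hr.congr fun j => ?_)
    rw [hf, PadicInt.norm_def]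
    push_cast; rfl
  refine ⟨x₀, fun x => ?_, fun j => e (s j), he 0, fun j => ?_, hx₀⟩
  · have hx : (x : ℤ_[2]) - x₀ ≠ 0 := by
      intro h
      have := hroot x
      rw [h, norm_zero, mul_zero, norm_eq_zero] at this
      exact hne x this
    refine ⟨hx, ?_⟩
    have h := hroot x
    rw [norm_eq_two_zpow_neg_valuation (hne x), PadicInt.norm_eq_zpow_neg_valuation hx] at h
    push_cast at h
    rw [← zpow_add₀ (by norm_num)] at h
    have := zpow_right_injective₀ (by norm_num : (0 : ℝ) < 2) (by norm_num) h
    omega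
  · rw [he, hsum (j + 1)]

/-! ### Differences of exponential sums via binomial expansion -/

/-- Expand both factors of `(1 + w) ^ y * ((1 + w) ^ D - 1)`. The second has no constant term,
whence the index `p.2 + 1`, and each of its coefficients retains most of the 2-divisibility of `D`.
-/
theorem sum_one_add_pow_sub {ι : Type*} (S : Finset ι) (a w : ι → ℤ) (y D : ℕ) :
    ∑ j ∈ S, a j * (1 + w j) ^ (y + D) - ∑ j ∈ S, a j * (1 + w j) ^ y =
      ∑ p ∈ Finset.range (y + 1) ×ˢ Finset.range D,
        (y.choose p.1 : ℤ) * (D.choose (p.2 + 1) : ℤ) *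
          ∑ j ∈ S, a j * w j ^ (p.1 + p.2 + 1) := by
  have h1 : ∀ x : ℤ, (1 + x) ^ y = ∑ s ∈ Finset.range (y + 1), x ^ s * (y.choose s : ℤ) := by
    intro x
    rw [add_comm, add_pow]; simp
  have h2 : ∀ x : ℤ, (1 + x) ^ D - 1 =
      ∑ r ∈ Finset.range D, x ^ (r + 1) * (D.choose (r + 1) : ℤ) := by
    intro x
    rw [add_comm, add_pow, Finset.sum_range_succ']; simp
  rw [← Finset.sum_sub_distrib]
  simp_rw [Finset.mul_sum]
  rw [Finset.sum_comm]
  refine Finset.sum_congr rfl fun j _ => ?_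
  have h3 : a j * (1 + w j) ^ (y + D) - a j * (1 + w j) ^ y =
      a j * ((1 + w j) ^ y * ((1 + w j) ^ D - 1)) := by ring
  rw [h3, h1, h2, Finset.sum_mul_sum, ← Finset.sum_product', Finset.mul_sum]
  refine Finset.sum_congr rfl fun p _ => ?_
  ring

/-- A binomial coefficient `D.choose r` is divisible by `D`, up to a 2-adic loss below `2 ^ r`. -/
theorem padic_two_norm_choose_succ_le (D r : ℕ) :
    ‖((D.choose (r + 1) : ℕ) : ℚ_[2])‖ ≤ ‖(D : ℚ_[2])‖ * 2 ^ r := by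
  rcases D with _ | D
  · simp
  have h := Nat.add_one_mul_choose_eq D r
  have h' : ((D + 1 : ℕ) : ℚ_[2]) * (D.choose r : ℕ) =
      ((D + 1).choose (r + 1) : ℕ) * ((r + 1 : ℕ) : ℚ_[2]) := by exact_mod_cast h
  have h1 : ‖((D.choose r : ℕ) : ℚ_[2])‖ ≤ 1 := by
    simpa using Padic.norm_int_le_one (p := 2) (D.choose r)
  have hr0 : ((r + 1 : ℕ) : ℚ_[2]) ≠ 0 := by exact_mod_cast Nat.succ_ne_zero r
  -- The loss is `ν(r + 1)`, at most `r` because `v < 2 ^ v ≤ r + 1` for `v = ν(r + 1)`.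
  have hr : (1 : ℝ) ≤ ‖((r + 1 : ℕ) : ℚ_[2])‖ * 2 ^ r := by
    have hv : padicValNat 2 (r + 1) ≤ r := by
      have h3 : 2 ^ padicValNat 2 (r + 1) ∣ r + 1 := pow_padicValNat_dvd
      have h4 := Nat.le_of_dvd (Nat.succ_pos r) h3
      have h5 : padicValNat 2 (r + 1) < 2 ^ padicValNat 2 (r + 1) := Nat.lt_two_pow_self
      omega
    rw [norm_eq_two_zpow_neg_valuation hr0, Padic.valuation_natCast, zpow_neg, zpow_natCast,
      ← div_eq_inv_mul, one_le_div (by positivity)]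
    exact pow_le_pow_right₀ (by norm_num) hv
  have h2 : ‖((D + 1 : ℕ) : ℚ_[2])‖ * ‖((D.choose r : ℕ) : ℚ_[2])‖ =
      ‖(((D + 1).choose (r + 1) : ℕ) : ℚ_[2])‖ * ‖((r + 1 : ℕ) : ℚ_[2])‖ := by
    rw [← norm_mul, h', norm_mul]
  have h3 := norm_nonneg ((D + 1 : ℕ) : ℚ_[2])
  have h4 := norm_nonneg (((D + 1).choose (r + 1) : ℕ) : ℚ_[2])
  calc _ ≤ ‖(((D + 1).choose (r + 1) : ℕ) : ℚ_[2])‖ * (‖((r + 1 : ℕ) : ℚ_[2])‖ * 2 ^ r) :=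
        le_mul_of_one_le_right h4 hr
    _ = ‖((D + 1 : ℕ) : ℚ_[2])‖ * ‖((D.choose r : ℕ) : ℚ_[2])‖ * 2 ^ r := by rw [h2]; ring
    _ ≤ _ := by
      gcongr
      exact mul_le_of_le_one_right h3 h1

theorem padic_two_norm_int_le_of_dvd {z : ℤ} {k : ℕ} (h : 2 ^ k ∣ z) :
    ‖(z : ℚ_[2])‖ ≤ (2 : ℝ) ^ (-(k : ℤ)) := by
  have := (Padic.norm_int_le_pow_iff_dvd (p := 2) z k).2 (by exact_mod_cast h)
  exact_mod_cast this

theorem padic_two_norm_int_eq {z : ℤ} {k : ℕ} (h : 2 ^ k ∣ z) (h' : ¬ 2 ^ (k + 1) ∣ z) :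
    ‖(z : ℚ_[2])‖ = (2 : ℝ) ^ (-(k : ℤ)) := by
  refine le_antisymm (padic_two_norm_int_le_of_dvd h) ?_
  by_contra hlt
  apply h'
  have h1 := (Padic.norm_int_le_pow_iff_dvd (p := 2) z (k + 1)).1 ?_
  · exact_mod_cast h1
  · have hz : (z : ℚ_[2]) ≠ 0 := by
      rintro h0
      exact h' (by rw [Int.cast_eq_zero.1 h0]; exact dvd_zero _)
    rw [norm_eq_two_zpow_neg_valuation hz] at hlt ⊢
    rw [not_le, zpow_lt_zpow_iff_right₀ (by norm_num)] at hlt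
    push_cast
    exact (zpow_le_zpow_iff_right₀ (by norm_num)).2 (by omega)

/-- The term at `(0, 0)` is `D` times the first coefficient, of valuation exactly `ν(D) + c`. At any
other `(s, r)` the valuation is at least `(ν(D) - r) + (c + s + r + 1)`, hence larger: the excess
`r` in `h2` pays for the loss in the binomial coefficient. -/
theorem norm_sum_one_add_pow_sub {ι : Type*} (S : Finset ι) (a w : ι → ℤ) (c : ℕ)
    (h1 : 2 ^ c ∣ ∑ j ∈ S, a j * w j) (h1' : ¬ 2 ^ (c + 1) ∣ ∑ j ∈ S, a j * w j)
    (h2 : ∀ r, 2 ≤ r → 2 ^ (c + r) ∣ ∑ j ∈ S, a j * w j ^ r) (y D : ℕ) :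
    ‖((∑ j ∈ S, a j * (1 + w j) ^ (y + D) - ∑ j ∈ S, a j * (1 + w j) ^ y : ℤ) : ℚ_[2])‖ =
      (2 : ℝ) ^ (-(c : ℤ)) * ‖(D : ℚ_[2])‖ := by
  rcases Nat.eq_zero_or_pos D with rfl | hD
  · simp
  have hDn : 0 < ‖(D : ℚ_[2])‖ := norm_pos_iff.2 (by exact_mod_cast hD.ne')
  have hc : (0 : ℝ) < 2 ^ (-(c : ℤ)) := by positivity
  have hmem : ((0, 0) : ℕ × ℕ) ∈ Finset.range (y + 1) ×ˢ Finset.range D := by simp [hD]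
  rw [sum_one_add_pow_sub, ← Finset.add_sum_erase _ _ hmem, Int.cast_add, Int.cast_sum]
  set A : ℚ_[2] := (((y.choose (0, 0).1 : ℤ) * (D.choose ((0, 0).2 + 1) : ℤ) *
          ∑ j ∈ S, a j * w j ^ ((0, 0).1 + (0, 0).2 + 1) : ℤ) : ℚ_[2]) with hA
  have hAn : ‖A‖ = (2 : ℝ) ^ (-(c : ℤ)) * ‖(D : ℚ_[2])‖ := by
    simp only [Nat.choose_zero_right, zero_add, Nat.choose_one_right, pow_one, Nat.cast_one,
      one_mul] at hA
    rw [hA, Int.cast_mul, norm_mul, padic_two_norm_int_eq h1 h1', mul_comm, Int.cast_natCast]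
  set B := ∑ p ∈ (Finset.range (y + 1) ×ˢ Finset.range D).erase (0, 0),
      (((y.choose p.1 : ℤ) * (D.choose (p.2 + 1) : ℤ) *
          ∑ j ∈ S, a j * w j ^ (p.1 + p.2 + 1) : ℤ) : ℚ_[2]) with hB
  have hBn : ‖B‖ ≤ (2 : ℝ) ^ (-(c : ℤ)) * ‖(D : ℚ_[2])‖ / 2 := by
    refine IsUltrametricDist.norm_sum_le_of_forall_le_of_nonneg (by positivity) ?_
    rintro ⟨s, r⟩ hp
    have hsr : 2 ≤ s + r + 1 := by
      rcases Nat.eq_zero_or_pos (s + r) with h | h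
      · obtain ⟨rfl, rfl⟩ : s = 0 ∧ r = 0 := by omega
        simp at hp
      · omega
    rw [Int.cast_mul, Int.cast_mul, norm_mul, norm_mul, Int.cast_natCast (D.choose _)]
    have e1 := Padic.norm_int_le_one (p := 2) (y.choose s)
    have e2 := padic_two_norm_choose_succ_le D r
    have e3 := padic_two_norm_int_le_of_dvd (h2 _ hsr)
    calc _ ≤ 1 * (‖(D : ℚ_[2])‖ * 2 ^ r) * (2 : ℝ) ^ (-((c + (s + r + 1) : ℕ) : ℤ)) := by gcongr
      _ ≤ 1 * (‖(D : ℚ_[2])‖ * 2 ^ r) * (2 : ℝ) ^ (-((c + (r + 1) : ℕ) : ℤ)) := by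
        gcongr
        · norm_num
        · omega
      _ = _ := by
        rw [zpow_neg, zpow_neg, zpow_natCast, zpow_natCast, pow_add, pow_succ]
        field_simp
  have hlt : ‖B‖ < ‖A‖ := by
    rw [hAn]
    have : 0 < (2 : ℝ) ^ (-(c : ℤ)) * ‖(D : ℚ_[2])‖ := by positivity
    linarith
  rw [Padic.add_eq_max_of_ne hlt.ne', max_eq_left hlt.le, hAn]

/-- The difference from the value at `y = 0` involves only coefficients with `r ≥ 1`, so it vanishes
modulo `2 ^ (c + 1)`. -/
theorem norm_sum_one_add_pow {ι : Type*} (S : Finset ι) (a w : ι → ℤ) (c : ℕ)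
    (h0 : 2 ^ c ∣ ∑ j ∈ S, a j) (h0' : ¬ 2 ^ (c + 1) ∣ ∑ j ∈ S, a j)
    (h1 : ∀ r, 1 ≤ r → 2 ^ (c + 1) ∣ ∑ j ∈ S, a j * w j ^ r) (y : ℕ) :
    ‖((∑ j ∈ S, a j * (1 + w j) ^ y : ℤ) : ℚ_[2])‖ = (2 : ℝ) ^ (-(c : ℤ)) := by
  have h := sum_one_add_pow_sub S a w 0 y
  have hd : (2 : ℤ) ^ (c + 1) ∣ ∑ j ∈ S, a j * (1 + w j) ^ y - ∑ j ∈ S, a j := by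
    simp only [zero_add, pow_zero, mul_one] at h
    rw [h]
    exact Finset.dvd_sum fun p _ => Dvd.dvd.mul_left (h1 _ (by omega)) _
  refine padic_two_norm_int_eq ?_ fun h' => h0' ?_
  · exact (dvd_iff_dvd_of_dvd_sub ((pow_dvd_pow 2 (Nat.le_succ c)).trans hd)).2 h0
  · exact (dvd_iff_dvd_of_dvd_sub hd).1 h'

/-! ### The finite computation -/

/-- The Mahler coefficient `∑ (n choose j) j ^ i (j ^ (2 ^ m) - 1) ^ r`, over odd `j`, of the
function `x ↦ T_n(2 ^ m * x + i)`. -/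
def mahlerCoeff (n i m r : ℕ) : ℕ :=
  ∑ t ∈ Finset.range ((n + 1) / 2),
    -- The quotient is the binomial coefficient, written so as to avoid Pascal's recursion in
    -- evaluation. The subtraction is never truncated.
    n.descFactorial (2 * t + 1) / (2 * t + 1).factorial * (2 * t + 1) ^ i *
      ((2 * t + 1) ^ 2 ^ m - 1) ^ r

/-- The finitely many divisibilities of Mahler coefficients that force the given behaviour. -/
def behaviourCheck (n i m : ℕ) : ClassBehaviour → Bool
  | .root c => decide (0 < c) && decide (0 < m) && decide (mahlerCoeff n i m 0 % 2 ^ c = 0) &&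
      decide (mahlerCoeff n i m 1 % 2 ^ (c + 1) = 2 ^ c) &&
      -- For `r > c / m` one has `(m + 1) * r ≥ c + r`, so the condition is automatic.
      (List.range (c / m + 1)).all fun r =>
        decide (r < 2) || decide (mahlerCoeff n i m r % 2 ^ (c + r) = 0)
  | .const c => (decide (n < 2) || decide (0 < c)) &&
      decide (mahlerCoeff n i m 0 % 2 ^ (c + 1) = 2 ^ c) &&
      -- For `r > c / (m + 1)` one has `(m + 1) * r ≥ c + 1`.
      (List.range (c / (m + 1) + 1)).all fun r =>
        decide (r < 1) || decide (mahlerCoeff n i m r % 2 ^ (c + 1) = 0)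

def behavioursCheck (n : ℕ) : Bool :=
  (stirlingTable n).all fun r => r.residues.all fun i =>
    decide (0 ≤ i) && behaviourCheck n i.toNat r.modExp r.behaviour

/-- The listed pairs `(i, m)`, each standing for the class `[i mod 2 ^ m]`. -/
def tableClasses (n : ℕ) : List (ℤ × ℕ) :=
  (stirlingTable n).flatMap fun r => r.residues.map fun i => (i, r.modExp)

def maxModExp (n : ℕ) : ℕ := (tableClasses n).foldr (fun e a => max e.2 a) 0

def partitionCheck (n : ℕ) : Bool :=
  (List.range (2 ^ maxModExp n)).all fun k =>
    ((tableClasses n).filter fun e => decide (((k : ℤ) - e.1) % 2 ^ e.2 = 0)).length == 1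

theorem behavioursCheck_eq_true {n : ℕ} (hn : n ≤ 36) : behavioursCheck n = true := by
  have h : ∀ n < 37, behavioursCheck n = true := by decide +kernel
  exact h n (by omega)

theorem partitionCheck_eq_true {n : ℕ} (hn : 1 ≤ n) (hn' : n ≤ 36) : partitionCheck n = true := by
  have h : ∀ n < 37, 1 ≤ n → partitionCheck n = true := by decide +kernel
  exact h n (by omega) hn

/-! ### Mahler coefficients and their automatic divisibility -/

theorem two_pow_succ_dvd_odd_pow_sub_one {j : ℤ} (hj : Odd j) (m : ℕ) :
    2 ^ (m + 1) ∣ j ^ 2 ^ m - 1 := by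
  induction m with
  | zero => simpa using (hj.sub_odd odd_one).two_dvd
  | succ m ih =>
    have h : j ^ 2 ^ (m + 1) - 1 = (j ^ 2 ^ m - 1) * (j ^ 2 ^ m + 1) := by ring
    rw [h, pow_succ]
    exact mul_dvd_mul ih (hj.pow.add_odd odd_one).two_dvd

theorem sum_filter_odd_range {M : Type*} [AddCommMonoid M] (f : ℕ → M) (n : ℕ) :
    ∑ j ∈ (Finset.range (n + 1)).filter Odd, f j =
      ∑ t ∈ Finset.range ((n + 1) / 2), f (2 * t + 1) := by
  symm
  refine Finset.sum_bij (fun t _ => 2 * t + 1) ?_ ?_ ?_ ?_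
  · intro t ht
    simp only [Finset.mem_range, Finset.mem_filter] at ht ⊢
    exact ⟨by omega, ⟨t, rfl⟩⟩
  · intro s _ t _ h
    omega
  · intro j hj
    simp only [Finset.mem_range, Finset.mem_filter] at hj
    obtain ⟨h, t, rfl⟩ := hj
    exact ⟨t, by simp only [Finset.mem_range]; omega, rfl⟩
  · intros; rfl

theorem cast_mahlerCoeff (n i m r : ℕ) :
    (mahlerCoeff n i m r : ℤ) = ∑ t ∈ Finset.range ((n + 1) / 2),
      ((n.choose (2 * t + 1) : ℤ) * (2 * (t : ℤ) + 1) ^ i) *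
        ((2 * (t : ℤ) + 1) ^ 2 ^ m - 1) ^ r := by
  unfold mahlerCoeff
  rw [Nat.cast_sum]
  refine Finset.sum_congr rfl fun t _ => ?_
  rw [← Nat.choose_eq_descFactorial_div_factorial, Nat.cast_mul, Nat.cast_mul, Nat.cast_pow,
    Nat.cast_pow, Nat.cast_sub (Nat.one_le_pow _ _ (by omega))]
  push_cast
  rfl

theorem two_pow_dvd_mahlerCoeff (n i m r : ℕ) :
    (2 : ℤ) ^ ((m + 1) * r) ∣ (mahlerCoeff n i m r : ℤ) := by
  rw [cast_mahlerCoeff]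
  refine Finset.dvd_sum fun t _ => Dvd.dvd.mul_left ?_ _
  rw [pow_mul]
  exact pow_dvd_pow_of_dvd (two_pow_succ_dvd_odd_pow_sub_one ⟨t, rfl⟩ m) r

theorem partialStirling_eq_sum_one_add_pow (n i m y : ℕ) :
    partialStirling n (2 ^ m * y + i) =
      ((∑ t ∈ Finset.range ((n + 1) / 2), ((n.choose (2 * t + 1) : ℤ) * (2 * (t : ℤ) + 1) ^ i) *
        (1 + ((2 * (t : ℤ) + 1) ^ 2 ^ m - 1)) ^ y : ℤ) : ℚ) := by
  unfold partialStirling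
  rw [sum_filter_odd_range (fun j => (n.choose j : ℚ) * (j : ℚ) ^ (2 ^ m * (y : ℤ) + i)),
    Int.cast_sum]
  refine Finset.sum_congr rfl fun t _ => ?_
  have h : (2 : ℤ) ^ m * y + i = ((2 ^ m * y + i : ℕ) : ℤ) := by push_cast; rfl
  rw [h, zpow_natCast]
  push_cast
  ring

/-! ### Continuity and negative exponents -/

/-- An odd `j` is a 2-adic unit, so `j ^ k` has norm 1 even for negative `k`, while `j ^ 2 ^ L` is
near 1. This carries results from natural to integer arguments. -/
theorem norm_partialStirling_add_two_pow_sub_le (n : ℕ) (k : ℤ) (L : ℕ) :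
    ‖(partialStirling n (k + 2 ^ L) : ℚ_[2]) - (partialStirling n k : ℚ_[2])‖ ≤
      (2 : ℝ) ^ (-(L : ℤ)) := by
  unfold partialStirling
  rw [← Rat.cast_sub, ← Finset.sum_sub_distrib, Rat.cast_sum]
  refine IsUltrametricDist.norm_sum_le_of_forall_le_of_nonneg (by positivity) fun j hj => ?_
  have hodd : Odd j := (Finset.mem_filter.1 hj).2
  have hj0 : (j : ℚ) ≠ 0 := by exact_mod_cast hodd.pos.ne'
  have h : (n.choose j : ℚ) * (j : ℚ) ^ (k + 2 ^ L) - (n.choose j : ℚ) * (j : ℚ) ^ k =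
      (j : ℚ) ^ k * (((n.choose j : ℤ) * ((j : ℤ) ^ 2 ^ L - 1) : ℤ) : ℚ) := by
    have h2 : ((2 : ℤ) ^ L) = ((2 ^ L : ℕ) : ℤ) := by push_cast; rfl
    rw [zpow_add₀ hj0, h2, zpow_natCast]
    push_cast
    ring
  have hnj : ‖(j : ℚ_[2])‖ = 1 := by
    rw [Padic.norm_natCast_eq_one_iff]
    exact (Nat.coprime_two_left (n := j)).2 hodd
  rw [h, Rat.cast_mul, Rat.cast_zpow, Rat.cast_natCast, Rat.cast_intCast, norm_mul, norm_zpow,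
    hnj, one_zpow, one_mul]
  refine padic_two_norm_int_le_of_dvd (Dvd.dvd.mul_left ?_ _)
  exact (pow_dvd_pow 2 (Nat.le_succ L)).trans
    (two_pow_succ_dvd_odd_pow_sub_one (by exact_mod_cast hodd) L)

/-- The function `x ↦ T_n(2 ^ m * x + i)` with values in `ℚ_[2]`. -/
noncomputable def stirlingOnClass (n i m : ℕ) (x : ℤ) : ℚ_[2] :=
  (partialStirling n (2 ^ m * x + i) : ℚ_[2])

theorem stirlingOnClass_natCast (n i m y : ℕ) :
    stirlingOnClass n i m y =
      ((∑ t ∈ Finset.range ((n + 1) / 2), ((n.choose (2 * t + 1) : ℤ) * (2 * (t : ℤ) + 1) ^ i) *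
        (1 + ((2 * (t : ℤ) + 1) ^ 2 ^ m - 1)) ^ y : ℤ) : ℚ_[2]) := by
  unfold stirlingOnClass
  rw [partialStirling_eq_sum_one_add_pow, Rat.cast_intCast]

theorem norm_stirlingOnClass_add_two_pow_sub_le (n i m : ℕ) (x : ℤ) (L : ℕ) :
    ‖stirlingOnClass n i m (x + 2 ^ L) - stirlingOnClass n i m x‖ ≤ (2 : ℝ) ^ (-(L : ℤ)) := by
  unfold stirlingOnClass
  have h : (2 : ℤ) ^ m * (x + 2 ^ L) + i = (2 ^ m * x + i) + 2 ^ (m + L) := by ring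
  rw [h]
  refine (norm_partialStirling_add_two_pow_sub_le n _ _).trans ?_
  exact zpow_le_zpow_right₀ (by norm_num) (by omega)

theorem valuation_stirlingOnClass (n i m : ℕ) (x : ℤ) :
    (stirlingOnClass n i m x).valuation = nuT n (2 ^ m * x + i) := by
  unfold stirlingOnClass nuT
  exact Padic.valuation_ratCast _

theorem stirlingOnClass_ne_zero {n : ℕ} (hn : 1 ≤ n) (i m : ℕ) (x : ℤ) :
    stirlingOnClass n i m x ≠ 0 := by
  unfold stirlingOnClass
  exact_mod_cast (partialStirling_pos hn _).ne'

theorem exists_add_two_pow_eq_natCast (x : ℤ) {L : ℕ} (hL : x.natAbs ≤ L) :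
    ∃ y : ℕ, x + 2 ^ L = y := by
  have h : L < 2 ^ L := Nat.lt_two_pow_self
  have h' : (L : ℤ) < 2 ^ L := by exact_mod_cast h
  exact ⟨(x + 2 ^ L).toNat, (Int.toNat_of_nonneg (by omega)).symm⟩

theorem two_pow_dvd_and_not_dvd_of_mod_eq {a c : ℕ} (h : a % 2 ^ (c + 1) = 2 ^ c) :
    (2 : ℤ) ^ c ∣ a ∧ ¬ (2 : ℤ) ^ (c + 1) ∣ a := by
  constructor
  · have h1 : 2 ^ c ∣ a := by
      rw [← Nat.div_add_mod a (2 ^ (c + 1)), h]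
      exact dvd_add (Dvd.dvd.mul_right (pow_dvd_pow 2 (Nat.le_succ c)) _) dvd_rfl
    exact_mod_cast h1
  · intro h1
    have h2 : 2 ^ (c + 1) ∣ a := by exact_mod_cast h1
    rw [Nat.dvd_iff_mod_eq_zero, h] at h2
    exact absurd h2 (by positivity)

/-! ### Behaviour on a single class -/

theorem norm_stirlingOnClass_sub {n i m c : ℕ} (h : behaviourCheck n i m (.root c) = true)
    (x y : ℤ) :
    ‖stirlingOnClass n i m x - stirlingOnClass n i m y‖ =
      (2 : ℝ) ^ (-(c : ℤ)) * ‖((x - y : ℤ) : ℚ_[2])‖ := by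
  simp only [behaviourCheck, Bool.and_eq_true, decide_eq_true_eq, List.all_eq_true,
    List.mem_range, Bool.or_eq_true] at h
  obtain ⟨⟨⟨⟨-, hm⟩, -⟩, h1⟩, h2⟩ := h
  obtain ⟨h1, h1'⟩ := two_pow_dvd_and_not_dvd_of_mod_eq h1
  have h2' : ∀ r, 2 ≤ r → (2 : ℤ) ^ (c + r) ∣ (mahlerCoeff n i m r : ℤ) := by
    intro r hr
    by_cases hlt : r < c / m + 1
    · have := Nat.dvd_of_mod_eq_zero ((h2 r hlt).resolve_left (by omega))
      exact_mod_cast this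
    · refine (pow_dvd_pow 2 ?_).trans (two_pow_dvd_mahlerCoeff n i m r)
      have := (Nat.div_lt_iff_lt_mul hm).1 (by omega : c / m < r)
      nlinarith
  simp only [cast_mahlerCoeff, pow_one] at h1 h1' h2'
  have hnat : ∀ y D : ℕ, ‖stirlingOnClass n i m ((y + D : ℕ) : ℤ) - stirlingOnClass n i m y‖ =
      (2 : ℝ) ^ (-(c : ℤ)) * ‖(D : ℚ_[2])‖ := by
    intro y D
    rw [stirlingOnClass_natCast, stirlingOnClass_natCast, ← Int.cast_sub]
    exact norm_sum_one_add_pow_sub _ _ _ c h1 h1' h2' y D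
  have hnat' : ∀ x y : ℕ, ‖stirlingOnClass n i m x - stirlingOnClass n i m y‖ =
      (2 : ℝ) ^ (-(c : ℤ)) * ‖((x - y : ℤ) : ℚ_[2])‖ := by
    intro x y
    rcases le_total y x with hxy | hxy
    · obtain ⟨D, rfl⟩ := Nat.exists_eq_add_of_le hxy
      rw [hnat]; simp
    · obtain ⟨D, rfl⟩ := Nat.exists_eq_add_of_le hxy
      rw [norm_sub_rev, hnat]; simp
  rcases eq_or_ne x y with rfl | hxy
  · simp
  have hpos : 0 < (2 : ℝ) ^ (-(c : ℤ)) * ‖((x - y : ℤ) : ℚ_[2])‖ := by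
    have : ((x - y : ℤ) : ℚ_[2]) ≠ 0 := by exact_mod_cast sub_ne_zero.2 hxy
    have := norm_pos_iff.2 this
    positivity
  -- Shift `x` and `y` by the same `2 ^ L`, large enough to make both natural and to perturb the
  -- difference by less than its claimed norm; the ultrametric inequality then preserves the norm.
  obtain ⟨L₀, hL₀⟩ := exists_pow_lt_of_lt_one hpos (by norm_num : (1 / 2 : ℝ) < 1)
  obtain ⟨L, hL, hxL, hyL⟩ : ∃ L, L₀ ≤ L ∧ x.natAbs ≤ L ∧ y.natAbs ≤ L :=
    ⟨L₀ + x.natAbs + y.natAbs, by omega, by omega, by omega⟩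
  have hsmall : (2 : ℝ) ^ (-(L : ℤ)) < (2 : ℝ) ^ (-(c : ℤ)) * ‖((x - y : ℤ) : ℚ_[2])‖ := by
    refine lt_of_le_of_lt ?_ hL₀
    rw [zpow_neg, zpow_natCast, one_div, inv_pow]
    exact inv_anti₀ (by positivity) (pow_le_pow_right₀ (by norm_num) hL)
  obtain ⟨X, hX⟩ := exists_add_two_pow_eq_natCast x hxL
  obtain ⟨Y, hY⟩ := exists_add_two_pow_eq_natCast y hyL
  have hXY := hnat' X Y
  have ex := norm_stirlingOnClass_add_two_pow_sub_le n i m x L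
  have ey := norm_stirlingOnClass_add_two_pow_sub_le n i m y L
  rw [← hX, ← hY, add_sub_add_right_eq_sub] at hXY
  set A := stirlingOnClass n i m (x + 2 ^ L) - stirlingOnClass n i m (y + 2 ^ L)
  set B := (stirlingOnClass n i m (y + 2 ^ L) - stirlingOnClass n i m y) -
    (stirlingOnClass n i m (x + 2 ^ L) - stirlingOnClass n i m x) with hB
  have hAB : stirlingOnClass n i m x - stirlingOnClass n i m y = A + B := by
    simp only [A, B]; ring
  have hBn : ‖B‖ < ‖A‖ := by
    rw [hXY]
    refine lt_of_le_of_lt ?_ hsmall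
    rw [hB, sub_eq_add_neg]
    refine (Padic.nonarchimedean _ _).trans (max_le ey ?_)
    rwa [norm_neg]
  rw [hAB, Padic.add_eq_max_of_ne hBn.ne', max_eq_left hBn.le, hXY]

theorem norm_stirlingOnClass_zero_le {n i m c : ℕ}
    (h : behaviourCheck n i m (.root c) = true) :
    ‖stirlingOnClass n i m 0‖ ≤ (2 : ℝ) ^ (-(c : ℤ)) := by
  simp only [behaviourCheck, Bool.and_eq_true, decide_eq_true_eq] at h
  have h0 := Nat.dvd_of_mod_eq_zero h.1.1.2
  have h0' : (2 : ℤ) ^ c ∣ (mahlerCoeff n i m 0 : ℤ) := by exact_mod_cast h0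
  rw [cast_mahlerCoeff] at h0'
  have e := stirlingOnClass_natCast n i m 0
  simp only [pow_zero, Nat.cast_zero] at e h0'
  rw [e]
  exact padic_two_norm_int_le_of_dvd h0'

theorem norm_stirlingOnClass {n i m c : ℕ} (h : behaviourCheck n i m (.const c) = true)
    (x : ℤ) : ‖stirlingOnClass n i m x‖ = (2 : ℝ) ^ (-(c : ℤ)) := by
  simp only [behaviourCheck, Bool.and_eq_true, decide_eq_true_eq, List.all_eq_true,
    List.mem_range, Bool.or_eq_true] at h
  obtain ⟨⟨-, h0⟩, h1⟩ := h
  obtain ⟨h0, h0'⟩ := two_pow_dvd_and_not_dvd_of_mod_eq h0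
  have h1' : ∀ r, 1 ≤ r → (2 : ℤ) ^ (c + 1) ∣ (mahlerCoeff n i m r : ℤ) := by
    intro r hr
    by_cases hlt : r < c / (m + 1) + 1
    · have := Nat.dvd_of_mod_eq_zero ((h1 r hlt).resolve_left (by omega))
      exact_mod_cast this
    · refine (pow_dvd_pow 2 ?_).trans (two_pow_dvd_mahlerCoeff n i m r)
      have := (Nat.div_lt_iff_lt_mul (Nat.succ_pos m)).1 (by omega : c / (m + 1) < r)
      nlinarith
  simp only [cast_mahlerCoeff, pow_zero, mul_one] at h0 h0' h1'
  -- With `c < L` the shift by `2 ^ L` changes the value by less than `2 ^ (-c)`.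
  obtain ⟨L, hL, hxL⟩ : ∃ L, c < L ∧ x.natAbs ≤ L := ⟨c + 1 + x.natAbs, by omega, by omega⟩
  obtain ⟨X, hX⟩ := exists_add_two_pow_eq_natCast x hxL
  have hXn : ‖stirlingOnClass n i m X‖ = (2 : ℝ) ^ (-(c : ℤ)) := by
    rw [stirlingOnClass_natCast]
    exact norm_sum_one_add_pow _ _ _ c h0 h0' h1' X
  have ex := norm_stirlingOnClass_add_two_pow_sub_le n i m x L
  rw [← hX] at hXn
  have hlt : ‖stirlingOnClass n i m x - stirlingOnClass n i m (x + 2 ^ L)‖ <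
      ‖stirlingOnClass n i m (x + 2 ^ L)‖ := by
    rw [norm_sub_rev, hXn]
    refine ex.trans_lt ((zpow_lt_zpow_iff_right₀ (by norm_num)).2 (by omega))
  rw [← sub_add_cancel (stirlingOnClass n i m x) (stirlingOnClass n i m (x + 2 ^ L)),
    Padic.add_eq_max_of_ne hlt.ne, max_eq_right hlt.le, hXn]

/-! ### The partition of the integers -/

theorem mem_congClass_iff {i k : ℤ} {m : ℕ} : k ∈ congClass i m ↔ (2 : ℤ) ^ m ∣ k - i := by
  rw [congClass, Set.mem_ofPred_eq, Int.modEq_comm, Int.modEq_iff_dvd]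

theorem self_mem_congClass (i : ℤ) (m : ℕ) : i ∈ congClass i m := by
  simp [mem_congClass_iff]

theorem exists_isTableEntry_iff {n : ℕ} {i : ℤ} {m : ℕ} :
    (∃ b, IsTableEntry n i m b) ↔ (i, m) ∈ tableClasses n := by
  simp only [IsTableEntry, tableClasses, List.mem_flatMap, List.mem_map, Prod.mk.injEq]
  constructor
  · rintro ⟨b, r, hr, hi, hm, -⟩
    exact ⟨r, hr, i, hi, rfl, hm⟩
  · rintro ⟨r, hr, _, hi, rfl, hm⟩
    exact ⟨_, r, hr, hi, hm, rfl⟩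

theorem le_maxModExp {n : ℕ} {e : ℤ × ℕ} (he : e ∈ tableClasses n) : e.2 ≤ maxModExp n := by
  unfold maxModExp
  generalize tableClasses n = l at he ⊢
  induction l with
  | nil => simp at he
  | cons a l ih =>
    rw [List.foldr_cons]
    rcases List.mem_cons.1 he with rfl | h
    · exact le_max_left _ _
    · exact (ih h).trans (le_max_right _ _)

/-- Every listed modulus divides `2 ^ maxModExp n`, so membership depends only on the residue of `k`
modulo that power, and the check counts exactly one entry for each residue. -/
theorem existsUnique_tableClass {n : ℕ} (h : partitionCheck n = true) (k : ℤ) :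
    ∃ e ∈ tableClasses n, k ∈ congClass e.1 e.2 ∧
      ∀ e' ∈ tableClasses n, k ∈ congClass e'.1 e'.2 → e' = e := by
  simp only [partitionCheck, List.all_eq_true, List.mem_range, beq_iff_eq] at h
  have hpos : (0 : ℤ) < 2 ^ maxModExp n := by positivity
  have hcast : (((k % 2 ^ maxModExp n).toNat : ℕ) : ℤ) = k % 2 ^ maxModExp n :=
    Int.toNat_of_nonneg (Int.emod_nonneg _ hpos.ne')
  have hlt : (k % 2 ^ maxModExp n).toNat < 2 ^ maxModExp n := by
    have := Int.emod_lt_of_pos k hpos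
    rw [← hcast] at this
    exact_mod_cast this
  have h1 := h _ hlt
  rw [List.length_eq_one_iff] at h1
  obtain ⟨e, he⟩ := h1
  have key : ∀ e' ∈ tableClasses n, (k ∈ congClass e'.1 e'.2 ↔ e' = e) := by
    intro e' he'
    rw [← List.mem_singleton, ← he, List.mem_filter, decide_eq_true_eq, hcast,
      and_iff_right he', ← Int.dvd_iff_emod_eq_zero, mem_congClass_iff]
    have hd : (2 : ℤ) ^ e'.2 ∣ k - k % 2 ^ maxModExp n :=
      (pow_dvd_pow 2 (le_maxModExp he')).trans (Int.dvd_self_sub_emod)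
    have heq : k - e'.1 = (k - k % 2 ^ maxModExp n) + (k % 2 ^ maxModExp n - e'.1) := by ring
    rw [heq, dvd_add_right hd]
  have hmem : e ∈ tableClasses n := by
    have : e ∈ [e] := List.mem_singleton.2 rfl
    rw [← he] at this
    exact (List.mem_filter.1 this).1
  exact ⟨e, hmem, (key e hmem).2 rfl, fun e' he' hk => (key e' he').1 hk⟩

theorem finite_and_isPartition_tableClasses {n : ℕ} (h : partitionCheck n = true) :
    {C : Set ℤ | ∃ i m b, IsTableEntry n i m b ∧ C = congClass i m}.Finite ∧
      Setoid.IsPartition {C : Set ℤ | ∃ i m b, IsTableEntry n i m b ∧ C = congClass i m} := by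
  have hset : {C : Set ℤ | ∃ i m b, IsTableEntry n i m b ∧ C = congClass i m} =
      (fun e : ℤ × ℕ => congClass e.1 e.2) '' {e | e ∈ tableClasses n} := by
    ext C
    simp only [Set.mem_ofPred_eq, Set.mem_image, Prod.exists]
    constructor
    · rintro ⟨i, m, b, hb, rfl⟩
      exact ⟨i, m, exists_isTableEntry_iff.1 ⟨b, hb⟩, rfl⟩
    · rintro ⟨i, m, he, rfl⟩
      obtain ⟨b, hb⟩ := exists_isTableEntry_iff.2 he
      exact ⟨i, m, b, hb, rfl⟩
  rw [hset]
  refine ⟨(List.finite_toSet _).image _, ?_, fun k => ?_⟩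
  · rintro ⟨e, -, he⟩
    have := self_mem_congClass e.1 e.2
    simp only at he
    rw [he] at this
    exact this
  · obtain ⟨e, he, hk, huniq⟩ := existsUnique_tableClass h k
    refine ⟨congClass e.1 e.2, ⟨⟨e, he, rfl⟩, hk⟩, ?_⟩
    rintro _ ⟨⟨e', he', rfl⟩, hk'⟩
    rw [huniq e' he' hk']

theorem IsTableEntry.behaviourCheck {n : ℕ} (hn : n ≤ 36) {i : ℤ} {m : ℕ} {b : ClassBehaviour}
    (h : IsTableEntry n i m b) :
    ((i.toNat : ℕ) : ℤ) = i ∧ behaviourCheck n i.toNat m b = true := by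
  obtain ⟨r, hr, hi, rfl, rfl⟩ := h
  have hc := behavioursCheck_eq_true hn
  simp only [behavioursCheck, List.all_eq_true, Bool.and_eq_true, decide_eq_true_eq] at hc
  obtain ⟨h1, h2⟩ := hc r hr i hi
  exact ⟨Int.toNat_of_nonneg h1, h2⟩

theorem theorem1p2 (n : ℕ) (hn : 1 ≤ n) (hn' : n ≤ 36) :
    -- the listed congruence classes form a finite partition of the integers
    ({C : Set ℤ | ∃ i m b, IsTableEntry n i m b ∧ C = congClass i m}.Finite ∧
      Setoid.IsPartition {C : Set ℤ | ∃ i m b, IsTableEntry n i m b ∧ C = congClass i m}) ∧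
    -- the classes that contain a zero, with the iteration that produces it
    (∀ (i : ℤ) (m c₀ : ℕ), IsTableEntry n i m (.root c₀) →
      0 < c₀ ∧
      ∃ x₀ : ℤ_[2],
        (∀ x : ℤ, (x : ℤ_[2]) - x₀ ≠ 0 ∧
          nuT n (2 ^ m * x + i) = (((x : ℤ_[2]) - x₀).valuation : ℤ) + (c₀ : ℤ)) ∧
        ∃ t : ℕ → ℕ,
          (t 0 : ℤ) = nuT n (2 ^ m * 0 + i) - (c₀ : ℤ) ∧
          (∀ j : ℕ, (t (j + 1) : ℤ) =
            nuT n (2 ^ m * (∑ l ∈ Finset.range (j + 1), (2 : ℤ) ^ t l) + i) - (c₀ : ℤ)) ∧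
          HasSum (fun j : ℕ => (2 : ℤ_[2]) ^ t j) x₀) ∧
    -- the classes on which the exponent is constant
    (∀ (i : ℤ) (m y₀ : ℕ), IsTableEntry n i m (.const y₀) →
      (2 ≤ n → 0 < y₀) ∧ ∀ k ∈ congClass i m, nuT n k = (y₀ : ℤ)) := by
  refine ⟨finite_and_isPartition_tableClasses (partitionCheck_eq_true hn hn'), ?_, ?_⟩
  · intro i m c h
    obtain ⟨hi, hb⟩ := h.behaviourCheck hn'
    have hroot := exists_padic_root (stirlingOnClass n i.toNat m) c
      (stirlingOnClass_ne_zero hn _ _) (norm_stirlingOnClass_zero_le hb)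
      (norm_stirlingOnClass_sub hb)
    simp only [valuation_stirlingOnClass, hi] at hroot
    refine ⟨?_, hroot⟩
    simp only [_root_.behaviourCheck, Bool.and_eq_true, decide_eq_true_eq] at hb
    exact hb.1.1.1.1
  · intro i m c h
    obtain ⟨hi, hb⟩ := h.behaviourCheck hn'
    refine ⟨fun h2 => ?_, fun k hk => ?_⟩
    · simp only [_root_.behaviourCheck, Bool.and_eq_true, Bool.or_eq_true,
        decide_eq_true_eq] at hb
      exact hb.1.1.resolve_left (by omega)
    · obtain ⟨x, hx⟩ := mem_congClass_iff.1 hk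
      have hk' : k = 2 ^ m * x + (i.toNat : ℕ) := by rw [hi, ← hx]; ring
      have hnorm := norm_stirlingOnClass hb x
      rw [norm_eq_two_zpow_neg_valuation (stirlingOnClass_ne_zero hn _ _ _),
        valuation_stirlingOnClass, ← hk'] at hnorm
      have := zpow_right_injective₀ (by norm_num : (0 : ℝ) < 2) (by norm_num) hnorm
      omega
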